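/- Let $\beta>0$. For positive integers $n,m$ and a probability $P$ on $\{0,1,\dots,m\}$, let $W=\{w_1,\dots,w_m\}$ and let $D_1,\dots,D_n$ be independent random subsets of $W$ with $\mathbb P(D_i=A)=P(|A|)\binom{m}{|A|}^{-1}$ for every $A\subset W$; put $X_i=|D_i|$, so that $X_i$ has distribution $P$. The passive random intersection graph $G_1^*(n,m,P)$ is the graph on $W$ in which two distinct vertices $w,w'$ are adjacent if and only if $\{w,w'\}\subset D_j$ for at least one $j$. Let $d$ be the degree of $w_1$ in $G_1^*(n,m,P)$, and let $L$ be the number of links incident to $w_1$, that is, the number of pairs $(j,w')$ with $w'\ne w_1$ and $w_1,w'\in D_j$. Consider a sequence of such graphs, where $n,m\to\infty$, $m/n\to\beta$, and $P$ varies along the sequence. Assume that (vii) $X_1$ converges in distribution to a random variable $Z$; (viii) $\mathbb E Z<\infty$ and $\mathbb E X_1\to\mathbb E Z$. ($Z$ then takes values in $\{0,1,2,\dots\}$ almost surely.) Let $\tilde Z_1,\tilde Z_2,\dots$ be independent random variables with the common distribution $\mathbb P(\tilde Z_1=j)=(j+1)\,\mathbb P(Z=j+1)/\mathbb E Z$,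 $j=0,1,2,\dots$, if $\mathbb E Z>0$, and $\tilde Z_i=0$ almost surely if $\mathbb E Z=0$. Let $\Lambda$ be a Poisson random variable with mean $\beta^{-1}\mathbb E Z$, independent of the sequence $(\tilde Z_i)_{i\ge1}$. Then $L$ converges in distribution to the compound Poisson random variable $d_*=\sum_{j=1}^{\Lambda}\tilde Z_j$. If, in addition, (ix) $\mathbb E Z^{4/3}<\infty$ and $\mathbb E X_1^{4/3}\to\mathbb E Z^{4/3}$, then $d$ also converges in distribution to $d_*$. -/

import Mathlib

open MeasureTheory ProbabilityTheory Filter Topology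

/-- The passive intersection graph on `W` of a collection `D` of `n` subsets of `W`: two distinct
elements are adjacent when at least `s` of the subsets contain both of them. -/
def passiveGraph {n : ℕ} {W : Type*} [DecidableEq W] (s : ℕ) (D : Fin n → Finset W) :
    SimpleGraph W where
  Adj w w' := w ≠ w' ∧
    s ≤ (Finset.univ.filter (fun j : Fin n => w ∈ D j ∧ w' ∈ D j)).card
  symm := ⟨fun w w' h => ⟨h.1.symm, by simpa only [and_comm] using h.2⟩⟩
  loopless := ⟨fun _ h => h.1 rfl⟩

instance {n : ℕ} {W : Type*} [DecidableEq W] (s : ℕ) (D : Fin n → Finset W) :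
    DecidableRel (passiveGraph s D).Adj :=
  fun w w' => inferInstanceAs (Decidable (w ≠ w' ∧
    s ≤ (Finset.univ.filter (fun j : Fin n => w ∈ D j ∧ w' ∈ D j)).card))

/-- The degree of `w` in the passive intersection graph. -/
def passiveDegree {n : ℕ} {W : Type*} [DecidableEq W] [Fintype W] (s : ℕ)
    (D : Fin n → Finset W) (w : W) : ℕ :=
  (passiveGraph s D).degree w

/-- The number of links incident to `w`: each set `D j` that contains `w` creates one link
between `w` and every other element `w'` of `D j`, and links are counted with multiplicity. -/
def linkCount {n : ℕ} {W : Type*} [DecidableEq W] [Fintype W]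
    (D : Fin n → Finset W) (w : W) : ℕ :=
  (Finset.univ.filter (fun p : Fin n × W => p.2 ≠ w ∧ w ∈ D p.1 ∧ p.2 ∈ D p.1)).card

/-- The size of a subset of `Fin m`, as an element of `{0, ..., m}`. -/
def sizeIndex {m : ℕ} (A : Finset (Fin m)) : Fin (m + 1) :=
  ⟨A.card, Nat.lt_succ_of_le (by simpa using Finset.card_le_univ A)⟩

/-- `D 0, ..., D (n - 1)` are independent random subsets of an `m`-element set, each of which
equals a given set `A` with probability `P(|A|) / binom(m, |A|)`, where `P` is a probability on
`{0, ..., m}`. -/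
structure IsRandomCollection {n m : ℕ} (P : PMF (Fin (m + 1))) {Ω : Type*} [MeasurableSpace Ω]
    (D : Fin n → Ω → Finset (Fin m)) (μ : Measure Ω) : Prop where
  measurable : ∀ i, Measurable (D i)
  indep : iIndepFun D μ
  law : ∀ i (A : Finset (Fin m)),
    μ.real {ω | D i ω = A} = (P (sizeIndex A)).toReal / (m.choose A.card : ℝ)

/-- The mean `∑ j, j * q j` of a sequence of probabilities `q` on `{0, 1, 2, ...}`. -/
noncomputable def seqMean (q : ℕ → ℝ) : ℝ := ∑' j : ℕ, (j : ℝ) * q j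

/-- The size-biased-minus-one sequence: `(j + 1) * q (j + 1) / mean` when the mean is positive,
and the point mass at `0` when the mean is zero. -/
noncomputable def tildeSeq (q : ℕ → ℝ) (j : ℕ) : ℝ :=
  if 0 < seqMean q then ((j : ℝ) + 1) * q (j + 1) / seqMean q else if j = 0 then 1 else 0

/-- The ingredients of a compound Poisson random variable: `Y 0, Y 1, ...` are independent with
common distribution `q` on `{0, 1, 2, ...}`, and `N` is Poisson with mean `r` and independent of
the sequence `Y`. -/
structure IsCompoundPoissonData (r : ℝ) (q : ℕ → ℝ) {Ω : Type*} [MeasurableSpace Ω]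
    (N : Ω → ℕ) (Y : ℕ → Ω → ℕ) (μ : Measure Ω) : Prop where
  measurable_N : Measurable N
  measurable_Y : ∀ i, Measurable (Y i)
  indep_Y : iIndepFun Y μ
  indep_N : IndepFun N (fun ω i => Y i ω) μ
  law_Y : ∀ i j, μ.real {ω | Y i ω = j} = q j
  law_N : μ.map N = poissonMeasure r.toNNReal

/-- The random sum of the first `N` terms of the sequence `Y`. -/
def randomSum {Ω : Type*} (N : Ω → ℕ) (Y : ℕ → Ω → ℕ) (ω : Ω) : ℕ :=
  ∑ j ∈ Finset.range (N ω), Y j ω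

/-!
The number of links at `w` is `∑ j, 1{w ∈ D j} (|D j| - 1)`, a sum of `n` independent terms with
the same law. Given its size, `D j` contains `w` with probability `|D j| / m`, so, with `X = |D 0|`,
the characteristic function of the number of links is
`(1 + m⁻¹ E[X (exp (i t (X - 1)) - 1)]) ^ n` (`IsRandomCollection.integral_cexp_linkCount`).
Convergence in distribution of `X` to `Z` together with convergence of the means makes `X`
uniformly integrable, hence the expectation converges to `E[Z (exp (i t (Z - 1)) - 1)]`
(`TendstoInDistribution.tendsto_integral_mul_comp`). As `n / m → β⁻¹`, the characteristic function
tends to `exp (β⁻¹ E[Z (exp (i t (Z - 1)) - 1)])`. The exponent equals `β⁻¹ E Z (φ t - 1)`, where `φ`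
is the characteristic function of the size-biased law shifted by one
(`integral_mul_mul_cexp_sub_one`), and this is the characteristic function of the compound Poisson
sum (`IsCompoundPoissonData.integral_cexp_randomSum`). Lévy's continuity theorem gives the claim for
the number of links.

The degree differs from the number of links only if some other element shares two different sets
with `w`. With probability close to one, no set containing `w` has more than `2 T` elements, for `T`
large, by uniform integrability. If only sets of at most `2 T` elements are considered, a union
bound over the other element and the two sets gives a probability of order
`m n² (T E X / m²)²`, that is `O(T² / m)`, which tends to zero for fixed `T`
(`IsRandomCollection.measureReal_passiveDegree_ne_linkCount_le`). The characteristic functions of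
the degree and of the number of links therefore have the same limit.
-/

/-! ### Limits of powers and expectations of discrete variables -/

/-- A version of `Complex.tendsto_one_add_pow_exp_of_tendsto` in which the exponent is an arbitrary
sequence tending to infinity. -/
theorem tendsto_one_add_pow_exp_of_tendsto_mul {N : ℕ → ℕ} (hN : Tendsto N atTop atTop)
    {c : ℕ → ℂ} {z : ℂ} (hc : Tendsto (fun k => (N k : ℂ) * c k) atTop (𝓝 z)) :
    Tendsto (fun k => (1 + c k) ^ N k) atTop (𝓝 (Complex.exp z)) := by
  have hNr : Tendsto (fun k => (N k : ℝ)) atTop atTop := tendsto_natCast_atTop_atTop.comp hN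
  have hN0 : ∀ᶠ k in atTop, 0 < N k := hN.eventually_gt_atTop 0
  have hcn : Tendsto (fun k => ‖c k‖) atTop (𝓝 0) := by
    have h := hc.norm.mul (tendsto_inv_atTop_zero.comp hNr)
    rw [mul_zero] at h
    refine h.congr' ?_
    filter_upwards [hN0] with k hk
    have : (N k : ℝ) ≠ 0 := by positivity
    simp only [norm_mul, Complex.norm_natCast, Function.comp]
    field_simp
  have hsmall : ∀ᶠ k in atTop, ‖c k‖ ≤ 1 / 2 :=
    (hcn.eventually_lt_const (by norm_num : (0 : ℝ) < 1 / 2)).mono fun _ h => h.le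
  have herr : Tendsto (fun k => (N k : ℂ) * (Complex.log (1 + c k) - c k)) atTop (𝓝 0) := by
    have h := hc.norm.mul hcn
    rw [mul_zero] at h
    refine squeeze_zero_norm' ?_ h
    filter_upwards [hsmall] with k hk
    have h1 := Complex.norm_log_one_add_sub_self_le (z := c k) (by linarith)
    have h2 : (1 - ‖c k‖)⁻¹ ≤ 2 := by
      rw [inv_le_comm₀ (by linarith) (by norm_num)]; norm_num; linarith
    have h3 : ‖c k‖ ^ 2 * (1 - ‖c k‖)⁻¹ / 2 ≤ ‖c k‖ ^ 2 := by
      nlinarith [sq_nonneg ‖c k‖]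
    rw [norm_mul, norm_mul, mul_assoc]
    gcongr
    nlinarith
  have hlog : Tendsto (fun k => (N k : ℂ) * Complex.log (1 + c k)) atTop (𝓝 z) := by
    have h := hc.add herr
    rw [add_zero] at h
    refine h.congr fun k => ?_
    ring
  refine ((Complex.continuous_exp.tendsto z).comp hlog).congr' ?_
  filter_upwards [hsmall] with k hk
  have hne : 1 + c k ≠ 0 := by
    intro h0
    have : c k = -1 := by linear_combination h0
    rw [this] at hk
    norm_num at hk
  simp only [Function.comp]
  rw [Complex.exp_nat_mul, Complex.exp_log hne]

theorem hasSum_integral_comp_nat {Ω E : Type*} [MeasurableSpace Ω] [NormedAddCommGroup E]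
    [NormedSpace ℝ E] [CompleteSpace E] {μ : Measure Ω} {Y : Ω → ℕ} (hY : AEMeasurable Y μ)
    {h : ℕ → E} (hi : Integrable (fun ω => h (Y ω)) μ) :
    HasSum (fun j => μ.real {ω | Y ω = j} • h j) (∫ ω, h (Y ω) ∂μ) := by
  have hi' : Integrable h (μ.map Y) := (integrable_map_measure (by fun_prop) hY).2 hi
  rw [← integral_map hY (by fun_prop)]
  have e : ∀ j, μ.real {ω | Y ω = j} = (μ.map Y).real {j} := fun j => by
    rw [map_measureReal_apply_of_aemeasurable hY (by simp)]; rfl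
  simp_rw [e]
  have h1 : Integrable h (Measure.sum fun j : ℕ => (μ.map Y) {j} • Measure.dirac j) := by
    rwa [Measure.sum_smul_dirac]
  have h2 := hasSum_integral_measure h1
  rw [Measure.sum_smul_dirac] at h2
  simpa [integral_smul_measure, measureReal_def] using h2

/-! ### The compound Poisson distribution -/

theorem integral_poissonMeasure_pow (r : NNReal) (z : ℂ) :
    ∫ n, z ^ n ∂(poissonMeasure r) = Complex.exp (r * (z - 1)) := by
  rw [integral_poissonMeasure]
  have e : ∀ n : ℕ, (Real.exp (-r) * (r : ℝ) ^ n / (n.factorial : ℝ)) • z ^ n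
      = Complex.exp (-r) * ((r * z) ^ n / (n.factorial : ℂ)) := fun n => by
    rw [Complex.real_smul]; push_cast; rw [mul_pow]; ring
  simp_rw [e]
  rw [tsum_mul_left, (NormedSpace.expSeries_div_hasSum_exp ((r : ℂ) * z)).tsum_eq,
    ← Complex.exp_eq_exp_ℂ, ← Complex.exp_add]
  congr 1; ring

theorem norm_cexp_real_mul_I (x y : ℝ) : ‖Complex.exp (x * y * Complex.I)‖ = 1 := by
  rw [← Complex.ofReal_mul, Complex.norm_exp_ofReal_mul_I]

theorem measurable_sum_range_eval :
    Measurable fun p : ℕ × (ℕ → ℕ) => ∑ j ∈ Finset.range p.1, p.2 j := by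
  refine measurable_from_prod_countable_right fun N => ?_
  dsimp only
  fun_prop

/-- The characteristic function of a compound Poisson variable, obtained by conditioning on the
number of terms. -/
theorem IsCompoundPoissonData.integral_cexp_randomSum {Ω : Type*} [MeasurableSpace Ω]
    {μ : Measure Ω} [IsProbabilityMeasure μ] {r : ℝ} {q : ℕ → ℝ} {N : Ω → ℕ} {Y : ℕ → Ω → ℕ}
    (h : IsCompoundPoissonData r q N Y μ) (t : ℝ) :
    ∫ ω, Complex.exp (t * (randomSum N Y ω : ℝ) * Complex.I) ∂μ
      = Complex.exp (r.toNNReal *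
          ((∫ ω, Complex.exp (t * (Y 0 ω : ℝ) * Complex.I) ∂μ) - 1)) := by
  have hYm : Measurable (fun ω i => Y i ω) := measurable_pi_lambda _ h.measurable_Y
  let F : ℕ × (ℕ → ℕ) → ℂ := fun p =>
    Complex.exp (t * ((∑ j ∈ Finset.range p.1, p.2 j : ℕ) : ℝ) * Complex.I)
  have hFm : Measurable F := by
    have := measurable_sum_range_eval
    fun_prop
  have hFn : ∀ p, ‖F p‖ ≤ 1 := fun p => (norm_cexp_real_mul_I _ _).le
  have hmap := (indepFun_iff_map_prod_eq_prod_map_map h.measurable_N.aemeasurable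
    hYm.aemeasurable).1 h.indep_N
  have hN : IsProbabilityMeasure (μ.map N) :=
    Measure.isProbabilityMeasure_map h.measurable_N.aemeasurable
  have hYp : IsProbabilityMeasure (μ.map (fun ω i => Y i ω)) :=
    Measure.isProbabilityMeasure_map hYm.aemeasurable
  have step : ∫ ω, F (N ω, fun i => Y i ω) ∂μ
      = ∫ n, ∫ y, F (n, y) ∂(μ.map (fun ω i => Y i ω)) ∂(μ.map N) := by
    rw [← integral_map (h.measurable_N.prodMk hYm).aemeasurable hFm.aestronglyMeasurable, hmap,
      integral_prod]
    exact Integrable.of_bound hFm.aestronglyMeasurable 1 (ae_of_all _ hFn)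
  have ident : ∀ i, ∫ ω, Complex.exp (t * (Y i ω : ℝ) * Complex.I) ∂μ
      = ∫ ω, Complex.exp (t * (Y 0 ω : ℝ) * Complex.I) ∂μ := fun i => by
    have hs : ∀ i, HasSum (fun j : ℕ => q j • Complex.exp (t * (j : ℝ) * Complex.I))
        (∫ ω, Complex.exp (t * (Y i ω : ℝ) * Complex.I) ∂μ) := fun i => by
      have hm := h.measurable_Y i
      have := hasSum_integral_comp_nat hm.aemeasurable
        (h := fun j => Complex.exp (t * (j : ℝ) * Complex.I)) (μ := μ)
        (Integrable.of_bound (by fun_prop) 1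
          (ae_of_all _ fun ω => (norm_cexp_real_mul_I _ _).le))
      simpa only [h.law_Y] using this
    exact (hs i).unique (hs 0)
  have inner : ∀ n, ∫ y, F (n, y) ∂(μ.map (fun ω i => Y i ω))
      = (∫ ω, Complex.exp (t * (Y 0 ω : ℝ) * Complex.I) ∂μ) ^ n := fun n => by
    have hFm' : Measurable (fun y => F (n, y)) := hFm.comp measurable_prodMk_left
    rw [integral_map hYm.aemeasurable hFm'.aestronglyMeasurable]
    have hi : iIndepFun (fun (i : Fin n) => Y i) μ := h.indep_Y.precomp Fin.val_injective
    have hp := hi.integral_fun_prod_comp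
      (f := fun _ j => Complex.exp (t * ((j : ℕ) : ℝ) * Complex.I))
      (fun i => (h.measurable_Y i).aemeasurable) (fun i => by fun_prop)
    simp only [ident, Finset.prod_const, Finset.card_univ, Fintype.card_fin] at hp
    rw [← hp]
    refine integral_congr_ae (ae_of_all _ fun ω => ?_)
    simp only [F]
    rw [← Complex.exp_sum, Finset.sum_range]
    push_cast
    rw [Finset.mul_sum, Finset.sum_mul]
  change ∫ ω, F (N ω, fun i => Y i ω) ∂μ = _
  rw [step]
  simp_rw [inner]
  rw [h.law_N, integral_poissonMeasure_pow]

/-! ### Convergence in distribution together with convergence of means -/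

section Moments

variable {Ω : ℕ → Type*} [∀ k, MeasurableSpace (Ω k)] {μ : ∀ k, Measure (Ω k)}
  [∀ k, IsProbabilityMeasure (μ k)] {ΩZ : Type*} [MeasurableSpace ΩZ] {ν : Measure ΩZ}
  [IsProbabilityMeasure ν] {X : ∀ k, Ω k → ℝ} {Z : ΩZ → ℝ}

/-- Lévy's continuity theorem for random variables living on varying probability spaces. -/
theorem tendstoInDistribution_of_charFun {Y : ∀ k, Ω k → ℝ} (hY : ∀ k, AEMeasurable (Y k) (μ k))
    (hZ : AEMeasurable Z ν)
    (h : ∀ t : ℝ, Tendsto (fun k => ∫ ω, Complex.exp (t * (Y k ω : ℝ) * Complex.I) ∂(μ k)) atTop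
      (𝓝 (∫ ω, Complex.exp (t * (Z ω : ℝ) * Complex.I) ∂ν))) :
    TendstoInDistribution Y atTop Z μ ν where
  forall_aemeasurable := hY
  aemeasurable_limit := hZ
  tendsto := by
    refine ProbabilityMeasure.tendsto_of_tendsto_charFun fun t => ?_
    simp only [ProbabilityMeasure.coe_mk, charFun_apply_real]
    rw [integral_map hZ (by fun_prop)]
    simp_rw [fun k => integral_map (hY k)
      (f := fun x : ℝ => Complex.exp (t * x * Complex.I)) (by fun_prop)]
    exact h t

theorem MeasureTheory.TendstoInDistribution.ae_mem_of_isClosed (h : TendstoInDistribution X atTop Z μ ν)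
    {F : Set ℝ} (hF : IsClosed F) (hX : ∀ k, ∀ᵐ ω ∂(μ k), X k ω ∈ F) : ∀ᵐ ω ∂ν, Z ω ∈ F := by
  have hl := ProbabilityMeasure.limsup_measure_closed_le_of_tendsto h.tendsto hF
  have h1 : ∀ k, (μ k).map (X k) F = 1 := fun k => by
    rw [Measure.map_apply_of_aemeasurable (h.forall_aemeasurable k) hF.measurableSet]
    exact (mem_ae_iff_prob_eq_one₀ ((h.forall_aemeasurable k).nullMeasurable hF.measurableSet)).1
      (hX k)
  simp only [ProbabilityMeasure.coe_mk, h1, limsup_const] at hl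
  rw [Measure.map_apply_of_aemeasurable h.aemeasurable_limit hF.measurableSet] at hl
  exact (mem_ae_iff_prob_eq_one₀ (h.aemeasurable_limit.nullMeasurable hF.measurableSet)).2
    (le_antisymm prob_le_one hl)

theorem MeasureTheory.TendstoInDistribution.tendsto_integral_comp {𝕜 : Type*} [RCLike 𝕜]
    (h : TendstoInDistribution X atTop Z μ ν) {f : ℝ → 𝕜} (hf : Continuous f) {C : ℝ}
    (hC : ∀ x, ‖f x‖ ≤ C) :
    Tendsto (fun k => ∫ ω, f (X k ω) ∂(μ k)) atTop (𝓝 (∫ ω, f (Z ω) ∂ν)) := by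
  have := (ProbabilityMeasure.tendsto_iff_forall_integral_rclike_tendsto 𝕜).1 h.tendsto
    (BoundedContinuousFunction.ofNormedAddCommGroup f hf C hC)
  simp only [ProbabilityMeasure.coe_mk, BoundedContinuousFunction.coe_ofNormedAddCommGroup] at this
  rw [integral_map h.aemeasurable_limit hf.aestronglyMeasurable] at this
  simpa only [fun k => integral_map (h.forall_aemeasurable k)
    (hf.aestronglyMeasurable (μ := (μ k).map (X k)))] using this

/-- Truncation of a real number to the interval `[0, T]`. -/
noncomputable def truncate (T x : ℝ) : ℝ := max 0 (min x T)

theorem continuous_truncate (T : ℝ) : Continuous (truncate T) := by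
  unfold truncate; fun_prop

theorem abs_truncate_le {T : ℝ} (hT : 0 ≤ T) (x : ℝ) : |truncate T x| ≤ T := by
  unfold truncate
  rw [abs_of_nonneg (le_max_left _ _)]
  exact max_le hT (min_le_right _ _)

theorem truncate_add_max {T x : ℝ} (hT : 0 ≤ T) (hx : 0 ≤ x) :
    truncate T x + max (x - T) 0 = x := by
  unfold truncate
  rcases le_total x T with h | h
  · rw [min_eq_left h, max_eq_right hx, max_eq_right (by linarith)]; ring
  · rw [min_eq_right h, max_eq_right hT, max_eq_left (by linarith)]; ring

theorem integral_max_sub (hZ : ∀ᵐ ω ∂ν, 0 ≤ Z ω) (hZi : Integrable Z ν) {T : ℝ} (hT : 0 ≤ T) :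
    ∫ ω, max (Z ω - T) 0 ∂ν = (∫ ω, Z ω ∂ν) - ∫ ω, truncate T (Z ω) ∂ν := by
  rw [← integral_sub hZi]
  · refine integral_congr_ae ?_
    filter_upwards [hZ] with ω hω
    linarith [truncate_add_max hT hω]
  · exact Integrable.of_bound
      ((continuous_truncate T).comp_aestronglyMeasurable hZi.aestronglyMeasurable) T
      (ae_of_all _ fun ω => abs_truncate_le hT _)

/-- Convergence of the means excludes escape of mass: the expected excess over a level `T`
converges, because the truncated means converge by weak convergence. -/
theorem MeasureTheory.TendstoInDistribution.tendsto_integral_max_sub (h : TendstoInDistribution X atTop Z μ ν)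
    (hX : ∀ k, ∀ᵐ ω ∂(μ k), 0 ≤ X k ω) (hXi : ∀ k, Integrable (X k) (μ k))
    (hZi : Integrable Z ν)
    (hm : Tendsto (fun k => ∫ ω, X k ω ∂(μ k)) atTop (𝓝 (∫ ω, Z ω ∂ν))) {T : ℝ} (hT : 0 ≤ T) :
    Tendsto (fun k => ∫ ω, max (X k ω - T) 0 ∂(μ k)) atTop (𝓝 (∫ ω, max (Z ω - T) 0 ∂ν)) := by
  have hZ : ∀ᵐ ω ∂ν, 0 ≤ Z ω := h.ae_mem_of_isClosed isClosed_Ici hX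
  have ht := h.tendsto_integral_comp (continuous_truncate T) (abs_truncate_le hT)
  rw [integral_max_sub hZ hZi hT]
  simp_rw [fun k => integral_max_sub (hX k) (hXi k) hT]
  exact hm.sub ht

theorem tendsto_integral_max_sub_atTop (hZi : Integrable Z ν) :
    Tendsto (fun T : ℝ => ∫ ω, max (Z ω - T) 0 ∂ν) atTop (𝓝 0) := by
  suffices h : Tendsto (fun T : ℝ => ∫ ω, max (Z ω - T) 0 ∂ν) atTop (𝓝 (∫ _, (0 : ℝ) ∂ν)) by
    simpa using h
  refine tendsto_integral_filter_of_dominated_convergence (fun ω => |Z ω|) ?_ ?_ hZi.abs ?_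
  · exact Eventually.of_forall fun T =>
      ((hZi.sub (integrable_const T)).sup (integrable_const 0)).aestronglyMeasurable
  · filter_upwards [eventually_ge_atTop 0] with T hT
    refine ae_of_all _ fun ω => ?_
    rw [Real.norm_eq_abs, abs_of_nonneg (le_max_right _ _)]
    exact max_le (by linarith [le_abs_self (Z ω)]) (abs_nonneg _)
  · refine ae_of_all _ fun ω => ?_
    refine tendsto_const_nhds.congr' ?_
    filter_upwards [eventually_ge_atTop (Z ω)] with T hT
    rw [max_eq_right (by linarith)]

theorem norm_integral_mul_sub_truncate_le {g : ℝ → ℂ} (hg : Continuous g) {C : ℝ}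
    (hC : ∀ x, ‖g x‖ ≤ C) (hZ : ∀ᵐ ω ∂ν, 0 ≤ Z ω) (hZi : Integrable Z ν) {T : ℝ} (hT : 0 ≤ T) :
    ‖(∫ ω, Z ω * g (Z ω) ∂ν) - ∫ ω, truncate T (Z ω) * g (Z ω) ∂ν‖
      ≤ C * ∫ ω, max (Z ω - T) 0 ∂ν := by
  have hgm : AEStronglyMeasurable (fun ω => g (Z ω)) ν :=
    hg.comp_aestronglyMeasurable hZi.aestronglyMeasurable
  have htr : Integrable (fun ω => truncate T (Z ω)) ν := Integrable.of_bound
      ((continuous_truncate T).comp_aestronglyMeasurable hZi.aestronglyMeasurable) T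
      (ae_of_all _ fun ω => abs_truncate_le hT _)
  have i1 : Integrable (fun ω => (Z ω : ℂ) * g (Z ω)) ν :=
    hZi.ofReal.mul_bdd hgm (ae_of_all _ fun ω => hC _)
  have i2 : Integrable (fun ω => (truncate T (Z ω) : ℂ) * g (Z ω)) ν :=
    htr.ofReal.mul_bdd hgm (ae_of_all _ fun ω => hC _)
  rw [← integral_sub i1 i2, ← integral_const_mul]
  refine norm_integral_le_of_norm_le
    (((hZi.sub (integrable_const T)).sup (integrable_const 0)).const_mul C) ?_
  filter_upwards [hZ] with ω hω
  have e := truncate_add_max hT hω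
  rw [← sub_mul]
  change ‖((Z ω : ℂ) - (truncate T (Z ω) : ℂ)) * _‖ ≤ C * max (Z ω - T) 0
  rw [← Complex.ofReal_sub, norm_mul, Complex.norm_real, Real.norm_eq_abs,
    show Z ω - truncate T (Z ω) = max (Z ω - T) 0 by linarith,
    abs_of_nonneg (le_max_right _ _), mul_comm]
  exact mul_le_mul_of_nonneg_right (hC _) (le_max_right _ _)

/-- If `X k` tends to `Z` in distribution and the means converge, the size-biased laws converge
weakly as well. -/
theorem MeasureTheory.TendstoInDistribution.tendsto_integral_mul_comp (h : TendstoInDistribution X atTop Z μ ν)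
    (hX : ∀ k, ∀ᵐ ω ∂(μ k), 0 ≤ X k ω) (hXi : ∀ k, Integrable (X k) (μ k))
    (hZi : Integrable Z ν)
    (hm : Tendsto (fun k => ∫ ω, X k ω ∂(μ k)) atTop (𝓝 (∫ ω, Z ω ∂ν)))
    {g : ℝ → ℂ} (hg : Continuous g) {C : ℝ} (hC : ∀ x, ‖g x‖ ≤ C) :
    Tendsto (fun k => ∫ ω, X k ω * g (X k ω) ∂(μ k)) atTop (𝓝 (∫ ω, Z ω * g (Z ω) ∂ν)) := by
  have hZ : ∀ᵐ ω ∂ν, 0 ≤ Z ω := h.ae_mem_of_isClosed isClosed_Ici hX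
  have hC0 : 0 ≤ C := (norm_nonneg _).trans (hC 0)
  rw [Metric.tendsto_nhds]
  intro ε hε
  have h1 : ∀ᶠ T : ℝ in atTop, C * ∫ ω, max (Z ω - T) 0 ∂ν < ε / 4 := by
    have := (tendsto_integral_max_sub_atTop hZi).const_mul C
    rw [mul_zero] at this
    exact this.eventually_lt_const (by linarith)
  obtain ⟨T, hT1, hT⟩ := (h1.and (eventually_ge_atTop 0)).exists
  have h2 : ∀ᶠ k in atTop, C * ∫ ω, max (X k ω - T) 0 ∂(μ k) < ε / 4 :=
    ((h.tendsto_integral_max_sub hX hXi hZi hm hT).const_mul C).eventually_lt_const hT1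
  have h3 := h.tendsto_integral_comp (f := fun x => (truncate T x : ℂ) * g x) (C := T * C)
    ((Complex.continuous_ofReal.comp (continuous_truncate T)).mul hg) (fun x => by
      rw [norm_mul, Complex.norm_real]
      exact mul_le_mul (abs_truncate_le hT x) (hC x) (norm_nonneg _) hT)
  have h4 := Metric.tendsto_nhds.1 h3 (ε / 4) (by linarith)
  filter_upwards [h2, h4] with k a b
  have c := norm_integral_mul_sub_truncate_le hg hC hZ hZi hT
  have d := norm_integral_mul_sub_truncate_le hg hC (hX k) (hXi k) hT
  rw [← dist_eq_norm] at c d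
  rw [dist_comm] at c
  have e1 := dist_triangle4 (∫ ω, X k ω * g (X k ω) ∂(μ k))
    (∫ ω, truncate T (X k ω) * g (X k ω) ∂(μ k)) (∫ ω, truncate T (Z ω) * g (Z ω) ∂ν)
    (∫ ω, Z ω * g (Z ω) ∂ν)
  linarith

end Moments

/-! ### Exponent of the limit law -/

/-- The exponent `r (φ - 1)` in the characteristic function of the compound Poisson limit, where
`φ` is the characteristic function of the size-biased law of `Z` shifted by one. -/
theorem integral_mul_mul_cexp_sub_one {ΩZ Ω' : Type*} [MeasurableSpace ΩZ] [MeasurableSpace Ω']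
    {ν : Measure ΩZ} [IsProbabilityMeasure ν] {ν' : Measure Ω'} [IsProbabilityMeasure ν']
    {Z : ΩZ → ℝ} (hZi : Integrable Z ν) (hZ : ∀ᵐ ω ∂ν, Z ω ∈ Set.range ((↑) : ℕ → ℝ))
    {Y : Ω' → ℕ} (hY : Measurable Y)
    (hlaw : ∀ j, ν'.real {ω | Y ω = j} = tildeSeq (fun j => ν.real {ω | Z ω = (j : ℝ)}) j)
    (t : ℝ) :
    ((∫ ω, Z ω ∂ν : ℝ) : ℂ) * ((∫ ω, Complex.exp (t * (Y ω : ℝ) * Complex.I) ∂ν') - 1)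
      = ∫ ω, (Z ω : ℂ) * (Complex.exp (t * (Z ω - 1 : ℝ) * Complex.I) - 1) ∂ν := by
  set q : ℕ → ℝ := fun j => ν.real {ω | Z ω = (j : ℝ)} with hq
  have hZm : AEMeasurable Z ν := hZi.aemeasurable
  have hNm : AEMeasurable (fun ω => ⌊Z ω⌋₊) ν := Nat.measurable_floor.comp_aemeasurable hZm
  have hNZ : ∀ᵐ ω ∂ν, ((⌊Z ω⌋₊ : ℕ) : ℝ) = Z ω := by
    filter_upwards [hZ] with ω ⟨j, hj⟩
    rw [← hj, Nat.floor_natCast]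
  have hqN : ∀ j, ν.real {ω | ⌊Z ω⌋₊ = j} = q j := fun j => by
    refine measureReal_congr ?_
    filter_upwards [hNZ] with ω hω
    refine propext (Iff.trans ?_ (Nat.cast_inj (R := ℝ)))|>.symm
    change Z ω = j ↔ _
    rw [hω]
  have hmean : HasSum (fun j : ℕ => (j : ℝ) * q j) (∫ ω, Z ω ∂ν) := by
    have h := hasSum_integral_comp_nat hNm (h := fun j : ℕ => (j : ℝ))
      (hZi.congr (hNZ.mono fun ω h => h.symm))
    rw [integral_congr_ae hNZ] at h
    simpa only [hqN, smul_eq_mul, mul_comm] using h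
  have hsm : seqMean q = ∫ ω, Z ω ∂ν := hmean.tsum_eq
  have hZ0 : 0 ≤ᵐ[ν] Z := by
    filter_upwards [hNZ] with ω hω
    rw [← hω]; exact Nat.cast_nonneg _
  have hm0 : 0 ≤ ∫ ω, Z ω ∂ν := integral_nonneg_of_ae hZ0
  -- If the mean is zero, then `Z = 0` almost surely and both sides vanish.
  rcases hm0.eq_or_lt with h0 | hpos
  · have hz : Z =ᵐ[ν] 0 := (integral_eq_zero_iff_of_nonneg_ae hZ0 hZi).1 h0.symm
    rw [← h0, Complex.ofReal_zero, zero_mul]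
    refine (integral_eq_zero_of_ae ?_).symm
    filter_upwards [hz] with ω hω
    rw [hω]; simp
  have hi : Integrable (fun ω => (Z ω : ℂ) * Complex.exp (t * (Z ω - 1 : ℝ) * Complex.I)) ν := by
    have := hZi.ofReal (𝕜 := ℂ)
    exact this.mul_bdd (c := 1) (by fun_prop) (ae_of_all _ fun ω => (norm_cexp_real_mul_I _ _).le)
  have hs1 : HasSum (fun j : ℕ => (q j : ℂ) * (j * Complex.exp (t * (j - 1 : ℝ) * Complex.I)))
      (∫ ω, (Z ω : ℂ) * Complex.exp (t * (Z ω - 1 : ℝ) * Complex.I) ∂ν) := by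
    have hc : (fun ω => ((⌊Z ω⌋₊ : ℝ) : ℂ) *
        Complex.exp (t * ((⌊Z ω⌋₊ : ℝ) - 1 : ℝ) * Complex.I)) =ᵐ[ν] fun ω => (Z ω : ℂ) * Complex.exp (t * (Z ω - 1 : ℝ) * Complex.I) := by
      filter_upwards [hNZ] with ω hω
      simp only [hω]
    have h := hasSum_integral_comp_nat hNm
      (h := fun j : ℕ => ((j : ℝ) : ℂ) * Complex.exp (t * ((j : ℝ) - 1 : ℝ) * Complex.I))
      (hi.congr hc.symm)
    rw [integral_congr_ae hc] at h
    simpa only [hqN, Complex.real_smul, Complex.ofReal_natCast] using h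
  have hs2 : HasSum (fun j : ℕ => (tildeSeq q j : ℂ) * Complex.exp (t * (j : ℝ) * Complex.I))
      (∫ ω, Complex.exp (t * (Y ω : ℝ) * Complex.I) ∂ν') := by
    have h := hasSum_integral_comp_nat hY.aemeasurable (μ := ν')
      (h := fun j : ℕ => Complex.exp (t * (j : ℝ) * Complex.I))
      (Integrable.of_bound (by fun_prop) 1 (ae_of_all _ fun ω => (norm_cexp_real_mul_I _ _).le))
    simpa only [hlaw, Complex.real_smul] using h
  -- The term `j = 0` vanishes, so shifting the index matches the series with the size-biased one.
  have hs3 := (hasSum_nat_add_iff' 1).2 hs1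
  simp only [Finset.sum_range_one, Nat.cast_zero, zero_mul, mul_zero, sub_zero] at hs3
  have hs4 := hs2.mul_left (((∫ ω, Z ω ∂ν : ℝ) : ℂ))
  have hEq : ((∫ ω, Z ω ∂ν : ℝ) : ℂ) * (∫ ω, Complex.exp (t * (Y ω : ℝ) * Complex.I) ∂ν')
      = ∫ ω, (Z ω : ℂ) * Complex.exp (t * (Z ω - 1 : ℝ) * Complex.I) ∂ν := by
    refine hs4.unique (hs3.congr_fun ?_)
    intro j
    have hne : ((∫ ω, Z ω ∂ν : ℝ) : ℂ) ≠ 0 := by exact_mod_cast hpos.ne'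
    simp only [tildeSeq, hsm, if_pos hpos]
    push_cast
    rw [add_sub_cancel_right]
    field_simp
  have hi' : Integrable (fun ω => (Z ω : ℂ)) ν := hZi.ofReal
  rw [mul_sub, mul_one, hEq, ← integral_complex_ofReal, ← integral_sub hi hi']
  refine integral_congr_ae (ae_of_all _ fun ω => ?_)
  simp only
  ring

/-! ### Expectations over a random set with exchangeable elements -/

namespace IsRandomCollection

variable {n m : ℕ} {P : PMF (Fin (m + 1))} {Ω : Type*} [MeasurableSpace Ω]
  {D : Fin n → Ω → Finset (Fin m)} {μ : Measure Ω} [IsProbabilityMeasure μ]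
  {E : Type*} [NormedAddCommGroup E]

theorem integrable_comp (hD : IsRandomCollection P D μ) (i : Fin n) (F : Finset (Fin m) → E) :
    Integrable (fun ω => F (D i ω)) μ := by
  have : IsProbabilityMeasure (μ.map (D i)) :=
    Measure.isProbabilityMeasure_map (hD.measurable i).aemeasurable
  exact (Integrable.of_finite (f := F) (μ := μ.map (D i))).comp_measurable (hD.measurable i)

variable [NormedSpace ℝ E] [CompleteSpace E]

theorem integral_comp (hD : IsRandomCollection P D μ) (i : Fin n) (F : Finset (Fin m) → E) :
    ∫ ω, F (D i ω) ∂μ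
      = ∑ A : Finset (Fin m), ((P (sizeIndex A)).toReal / (m.choose A.card : ℝ)) • F A := by
  have : IsProbabilityMeasure (μ.map (D i)) :=
    Measure.isProbabilityMeasure_map (hD.measurable i).aemeasurable
  rw [← integral_map (f := F) (hD.measurable i).aemeasurable
    (Integrable.of_finite (f := F) (μ := μ.map (D i))).aestronglyMeasurable,
    integral_fintype .of_finite]
  refine Finset.sum_congr rfl fun A _ => ?_
  rw [← hD.law i A, map_measureReal_apply (hD.measurable i) (measurableSet_singleton A)]
  rfl

theorem integral_comp_congr (hD : IsRandomCollection P D μ) (i j : Fin n)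
    (F : Finset (Fin m) → E) : ∫ ω, F (D i ω) ∂μ = ∫ ω, F (D j ω) ∂μ := by
  rw [hD.integral_comp, hD.integral_comp]

/-- The law of each random set is invariant under permutations of the ground set. -/
theorem integral_comp_map (hD : IsRandomCollection P D μ) (i : Fin n) (σ : Equiv.Perm (Fin m))
    (F : Finset (Fin m) → E) :
    ∫ ω, F ((D i ω).map σ.toEmbedding) ∂μ = ∫ ω, F (D i ω) ∂μ := by
  rw [hD.integral_comp, hD.integral_comp i (fun A => F (A.map σ.toEmbedding))]
  refine Fintype.sum_equiv σ.finsetCongr _ _ fun A => ?_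
  simp [sizeIndex, Equiv.finsetCongr]

/-- Conditionally on its size, the random set contains a given element with probability
`|D| / m`. This follows from invariance under transpositions by summing over all elements. -/
theorem smul_integral_ite_mem (hD : IsRandomCollection P D μ) (i : Fin n) (w : Fin m)
    (g : ℕ → E) :
    (m : ℝ) • ∫ ω, (if w ∈ D i ω then g (D i ω).card else 0) ∂μ
      = ∫ ω, ((D i ω).card : ℝ) • g (D i ω).card ∂μ := by
  have hw : ∀ w' : Fin m, ∫ ω, (if w' ∈ D i ω then g (D i ω).card else 0) ∂μ
      = ∫ ω, (if w ∈ D i ω then g (D i ω).card else 0) ∂μ := fun w' => by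
    rw [← hD.integral_comp_map i (Equiv.swap w w')
      (fun A => if w' ∈ A then g A.card else 0)]
    simp [Finset.mem_map_equiv]
  have hs : ∑ w' : Fin m, ∫ ω, (if w' ∈ D i ω then g (D i ω).card else 0) ∂μ
      = ∫ ω, ((D i ω).card : ℝ) • g (D i ω).card ∂μ := by
    rw [← integral_finsetSum _ fun w' _ =>
      hD.integrable_comp i (fun A => if w' ∈ A then g A.card else 0)]
    refine integral_congr_ae (ae_of_all _ fun ω => ?_)
    simp only [Finset.sum_ite_mem, Finset.univ_inter, Finset.sum_const, Nat.cast_smul_eq_nsmul]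
  rw [← hs]
  simp only [hw, Finset.sum_const, Finset.card_univ, Fintype.card_fin, Nat.cast_smul_eq_nsmul]

/-- Given the size and that the random set contains `w`, it contains a given second element with
probability `(|D| - 1) / (m - 1)`. -/
theorem smul_integral_ite_mem_mem (hD : IsRandomCollection P D μ) (i : Fin n) {w w' : Fin m}
    (hne : w' ≠ w) (g : ℕ → E) :
    ((m : ℝ) - 1) • ∫ ω, (if w ∈ D i ω ∧ w' ∈ D i ω then g (D i ω).card else 0) ∂μ
      = ∫ ω, (if w ∈ D i ω then (((D i ω).card : ℝ) - 1) • g (D i ω).card else 0) ∂μ := by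
  have hw : ∀ v ∈ Finset.univ.erase w,
      ∫ ω, (if w ∈ D i ω ∧ v ∈ D i ω then g (D i ω).card else 0) ∂μ
      = ∫ ω, (if w ∈ D i ω ∧ w' ∈ D i ω then g (D i ω).card else 0) ∂μ := fun v hv => by
    rw [← hD.integral_comp_map i (Equiv.swap v w')
      (fun A => if w ∈ A ∧ v ∈ A then g A.card else 0)]
    simp [Finset.mem_map_equiv, Equiv.swap_apply_of_ne_of_ne (Finset.ne_of_mem_erase hv).symm
      hne.symm]
  have hs : ∑ v ∈ Finset.univ.erase w,
        ∫ ω, (if w ∈ D i ω ∧ v ∈ D i ω then g (D i ω).card else 0) ∂μ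
      = ∫ ω, (if w ∈ D i ω then (((D i ω).card : ℝ) - 1) • g (D i ω).card else 0) ∂μ := by
    rw [← integral_finsetSum _ fun v _ =>
      hD.integrable_comp i (fun A => if w ∈ A ∧ v ∈ A then g A.card else 0)]
    refine integral_congr_ae (ae_of_all _ fun ω => ?_)
    by_cases h : w ∈ D i ω
    · have e : (Finset.univ.erase w) ∩ D i ω = (D i ω).erase w := by
        ext v; simp
      have h1 : 1 ≤ (D i ω).card := Finset.card_pos.2 ⟨w, h⟩
      simp only [h, true_and, if_true, Finset.sum_ite_mem, e, Finset.sum_const,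
        Finset.card_erase_of_mem h]
      rw [← Nat.cast_smul_eq_nsmul ℝ, Nat.cast_sub h1, Nat.cast_one]
    · simp [h]
  rw [← hs, Finset.sum_congr rfl hw, Finset.sum_const, Finset.card_erase_of_mem (Finset.mem_univ _),
    Finset.card_univ, Fintype.card_fin, ← Nat.cast_smul_eq_nsmul ℝ,
    Nat.cast_sub (Nat.one_le_iff_ne_zero.2 (by have := w.pos; omega)), Nat.cast_one]

end IsRandomCollection

/-! ### The number of links -/

theorem linkCount_eq_sum {n : ℕ} {W : Type*} [DecidableEq W] [Fintype W]
    (D : Fin n → Finset W) (w : W) :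
    linkCount D w = ∑ j, if w ∈ D j then (D j).card - 1 else 0 := by
  unfold linkCount
  rw [Finset.card_filter, ← Finset.univ_product_univ, Finset.sum_product]
  refine Finset.sum_congr rfl fun j _ => ?_
  rw [← Finset.card_filter]
  by_cases h : w ∈ D j
  · rw [if_pos h, ← Finset.card_erase_of_mem h]
    congr 1
    ext v; simp [h]
  · simp [h]

/-- The number of links at `w` is a sum of `n` independent terms, each equal to `|D| - 1` with
conditional probability `|D| / m` and to `0` otherwise. -/
theorem IsRandomCollection.integral_cexp_linkCount {n m : ℕ} [NeZero n] [NeZero m]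
    {P : PMF (Fin (m + 1))} {Ω : Type*} [MeasurableSpace Ω]
    {D : Fin n → Ω → Finset (Fin m)} {μ : Measure Ω} [IsProbabilityMeasure μ]
    (hD : IsRandomCollection P D μ) (w : Fin m) (t : ℝ) :
    ∫ ω, Complex.exp (t * (linkCount (fun i => D i ω) w : ℝ) * Complex.I) ∂μ
      = (1 + (m : ℂ)⁻¹ * ∫ ω, (((D 0 ω).card : ℝ) : ℂ) *
          (Complex.exp (t * (((D 0 ω).card : ℝ) - 1 : ℝ) * Complex.I) - 1) ∂μ) ^ n := by
  let G : ℕ → ℂ := fun a => Complex.exp (t * ((a : ℝ) - 1 : ℝ) * Complex.I) - 1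
  let H : Finset (Fin m) → ℂ := fun A => 1 + if w ∈ A then G A.card else 0
  have hH : ∀ ω, Complex.exp (t * (linkCount (fun i => D i ω) w : ℝ) * Complex.I)
      = ∏ i, H (D i ω) := fun ω => by
    rw [linkCount_eq_sum]
    push_cast
    rw [Finset.mul_sum, Finset.sum_mul, Complex.exp_sum]
    refine Finset.prod_congr rfl fun i _ => ?_
    by_cases h : w ∈ D i ω
    · have h1 : 1 ≤ (D i ω).card := Finset.card_pos.2 ⟨w, h⟩
      simp [H, G, h, Nat.cast_sub h1]
    · simp [H, h]
  simp_rw [hH]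
  rw [hD.indep.integral_fun_prod_comp (f := fun _ => H) (fun i => (hD.measurable i).aemeasurable)
    (fun i => by
      have := Measure.isProbabilityMeasure_map (μ := μ) (hD.measurable i).aemeasurable
      exact (Integrable.of_finite (f := H)).aestronglyMeasurable)]
  rw [Finset.prod_congr rfl fun i _ => hD.integral_comp_congr i 0 H, Finset.prod_const,
    Finset.card_univ, Fintype.card_fin]
  congr 1
  simp only [H]
  rw [integral_add (integrable_const _)
    (hD.integrable_comp 0 (fun A => if w ∈ A then G A.card else 0))]
  have h := hD.smul_integral_ite_mem 0 w G
  simp only [Complex.real_smul] at h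
  rw [← h]
  have hm : (m : ℂ) ≠ 0 := by exact_mod_cast NeZero.ne m
  simp [hm]

/-! ### Comparison of the degree and the number of links -/

/-- If no other element shares two different sets with `w`, then links at `w` and neighbours of `w`
correspond bijectively. -/
theorem passiveDegree_eq_linkCount {n : ℕ} {W : Type*} [DecidableEq W] [Fintype W]
    (D : Fin n → Finset W) (w : W)
    (h : ∀ w' ≠ w, ∀ i j, w ∈ D i → w' ∈ D i → w ∈ D j → w' ∈ D j → i = j) :
    passiveDegree 1 D w = linkCount D w := by
  unfold passiveDegree linkCount
  rw [← SimpleGraph.card_neighborFinset_eq_degree]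
  symm
  refine Finset.card_nbij Prod.snd ?_ ?_ ?_
  · intro p hp
    simp only [Finset.coe_filter, Finset.mem_univ, true_and, Set.mem_ofPred_eq] at hp
    refine (SimpleGraph.mem_neighborFinset _ _ _).2 ?_
    exact ⟨hp.1.symm, Finset.card_pos.2 ⟨p.1, by simpa using hp.2⟩⟩
  · intro p hp p' hp' hpp
    simp only [Finset.coe_filter, Finset.mem_univ, true_and, Set.mem_ofPred_eq] at hp hp'
    rw [← hpp] at hp'
    exact Prod.ext (h p.2 hp.1 _ _ hp.2.1 hp.2.2 hp'.2.1 hp'.2.2) hpp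
  · intro v hv
    replace hv : w ≠ v ∧ 1 ≤ (Finset.univ.filter (fun j => w ∈ D j ∧ v ∈ D j)).card :=
      (SimpleGraph.mem_neighborFinset _ _ _).1 hv
    obtain ⟨j, hj⟩ := Finset.card_pos.1 hv.2
    exact ⟨(j, v), by simpa using ⟨hv.1.symm, by simpa using hj⟩, rfl⟩

namespace IsRandomCollection

variable {n m : ℕ} {P : PMF (Fin (m + 1))} {Ω : Type*} [MeasurableSpace Ω]
  {D : Fin n → Ω → Finset (Fin m)} {μ : Measure Ω}

theorem measurable_comp_family (hD : IsRandomCollection P D μ) {α : Type*} [MeasurableSpace α]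
    (f : (Fin n → Finset (Fin m)) → α) : Measurable (fun ω => f (fun i => D i ω)) :=
  (measurable_of_finite f).comp (measurable_pi_lambda _ hD.measurable)

theorem measureReal_eq_integral_ite (hD : IsRandomCollection P D μ) (i : Fin n)
    (p : Finset (Fin m) → Prop) [DecidablePred p] :
    μ.real {ω | p (D i ω)} = ∫ ω, (if p (D i ω) then (1 : ℝ) else 0) ∂μ := by
  have hm : MeasurableSet {ω | p (D i ω)} := hD.measurable i (Set.toFinite {A | p A}).measurableSet
  rw [← integral_indicator_one hm]
  simp only [Set.indicator_apply, Set.mem_ofPred_eq, Pi.one_apply]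

variable [IsProbabilityMeasure μ]

/-- Sets with more than `2 * T` elements that contain `w` are rare: the constant `2` comes from
`x ≤ 2 * (x - T)` for `x > 2 * T`. -/
theorem measureReal_mem_and_lt_card_le [NeZero n] [NeZero m] (hD : IsRandomCollection P D μ)
    (w : Fin m) (T : ℕ) (i : Fin n) :
    μ.real {ω | w ∈ D i ω ∧ 2 * T < (D i ω).card}
      ≤ (m : ℝ)⁻¹ * (2 * ∫ ω, max (((D 0 ω).card : ℝ) - T) 0 ∂μ) := by
  have hm : (0 : ℝ) < m := by exact_mod_cast NeZero.pos m
  rw [hD.measureReal_eq_integral_ite i (fun A => w ∈ A ∧ 2 * T < A.card),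
    hD.integral_comp_congr i 0 (fun A => if w ∈ A ∧ 2 * T < A.card then (1 : ℝ) else 0),
    ← div_eq_inv_mul, le_div_iff₀' hm]
  have h := hD.smul_integral_ite_mem 0 w (fun a => if 2 * T < a then (1 : ℝ) else 0)
  simp only [← ite_and, smul_eq_mul] at h
  rw [h, ← integral_const_mul]
  refine integral_mono
    (hD.integrable_comp 0 (fun A => (A.card : ℝ) * if 2 * T < A.card then (1 : ℝ) else 0))
    (hD.integrable_comp 0 (fun A => 2 * max ((A.card : ℝ) - T) 0)) fun ω => ?_
  simp only
  split_ifs with hc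
  · have : (2 * T : ℝ) < (D 0 ω).card := by exact_mod_cast hc
    linarith [le_max_left (((D 0 ω).card : ℝ) - T) 0]
  · rw [mul_zero]; positivity

theorem measureReal_mem_mem_card_le_le [NeZero n] (hD : IsRandomCollection P D μ) (hm : 2 ≤ m)
    {w w' : Fin m} (hne : w' ≠ w) (S : ℕ) (i : Fin n) :
    μ.real {ω | (w ∈ D i ω ∧ w' ∈ D i ω) ∧ (D i ω).card ≤ S}
      ≤ S * (∫ ω, ((D 0 ω).card : ℝ) ∂μ) / (m * (m - 1)) := by
  have hm2 : (2 : ℝ) ≤ m := by exact_mod_cast hm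
  rw [hD.measureReal_eq_integral_ite i (fun A => (w ∈ A ∧ w' ∈ A) ∧ A.card ≤ S),
    hD.integral_comp_congr i 0 (fun A => if (w ∈ A ∧ w' ∈ A) ∧ A.card ≤ S then (1 : ℝ) else 0)]
  have h := hD.smul_integral_ite_mem_mem 0 hne (fun a => if a ≤ S then (1 : ℝ) else 0)
  have h1 := hD.smul_integral_ite_mem 0 w (fun _ => (S : ℝ))
  simp only [← ite_and, smul_eq_mul] at h h1
  rw [integral_mul_const] at h1
  rw [le_div_iff₀ (by nlinarith), mul_comm, mul_assoc, h, mul_comm (S : ℝ), ← h1]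
  refine mul_le_mul_of_nonneg_left ?_ (by linarith)
  refine integral_mono
    (hD.integrable_comp 0 (fun A => if w ∈ A then
      ((A.card : ℝ) - 1) * (if A.card ≤ S then (1 : ℝ) else 0) else 0))
    (hD.integrable_comp 0 (fun A => if w ∈ A then (S : ℝ) else 0)) fun ω => ?_
  simp only
  split_ifs with h1 h2
  · have : ((D 0 ω).card : ℝ) ≤ S := by exact_mod_cast h2
    linarith
  · rw [mul_zero]; positivity
  · exact le_rfl

/-- The degree differs from the number of links only if some neighbour is linked twice. Sets with
more than `2 * T` elements are discarded using the tail of the size-biased law; for the remaining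
ones the union bound runs over the neighbour and the two sets that contain it. -/
theorem measureReal_passiveDegree_ne_linkCount_le [NeZero n] [NeZero m]
    (hD : IsRandomCollection P D μ) (hm : 2 ≤ m) (w : Fin m) (T : ℕ) :
    μ.real {ω | passiveDegree 1 (fun i => D i ω) w ≠ linkCount (fun i => D i ω) w}
      ≤ n * ((m : ℝ)⁻¹ * (2 * ∫ ω, max (((D 0 ω).card : ℝ) - T) 0 ∂μ))
        + m * n ^ 2 * ((2 * T : ℕ) * (∫ ω, ((D 0 ω).card : ℝ) ∂μ) / (m * (m - 1))) ^ 2 := by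
  have hm2 : (2 : ℝ) ≤ m := by exact_mod_cast hm
  set q : ℝ := (2 * T : ℕ) * (∫ ω, ((D 0 ω).card : ℝ) ∂μ) / (m * (m - 1)) with hq
  let A : Fin n → Set Ω := fun i => {ω | w ∈ D i ω ∧ 2 * T < (D i ω).card}
  let B : Fin m → Fin n → Set Ω := fun v i =>
    {ω | (w ∈ D i ω ∧ v ∈ D i ω) ∧ (D i ω).card ≤ 2 * T}
  let s : Finset (Fin m × Fin n × Fin n) := Finset.univ.filter fun p => p.1 ≠ w ∧ p.2.1 ≠ p.2.2
  have hsub : {ω | passiveDegree 1 (fun i => D i ω) w ≠ linkCount (fun i => D i ω) w}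
      ⊆ (⋃ i ∈ (Finset.univ : Finset (Fin n)), A i) ∪ ⋃ p ∈ s, B p.1 p.2.1 ∩ B p.1 p.2.2 := by
    intro ω hω
    by_contra hcon
    simp only [Set.mem_union, Set.mem_iUnion, not_or, not_exists] at hcon
    refine hω (passiveDegree_eq_linkCount _ _ fun v hv i j h1 h2 h3 h4 => ?_)
    by_contra hij
    have hle : ∀ i, w ∈ D i ω → (D i ω).card ≤ 2 * T := fun i hi => by
      by_contra hlt
      exact hcon.1 i (Finset.mem_univ i) ⟨hi, not_le.1 hlt⟩
    exact hcon.2 (v, i, j) (by simp [s, hv, hij])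
      ⟨⟨⟨h1, h2⟩, hle i h1⟩, ⟨⟨h3, h4⟩, hle j h3⟩⟩
  refine (measureReal_mono hsub).trans ((measureReal_union_le _ _).trans (add_le_add ?_ ?_))
  · refine (measureReal_biUnion_finset_le _ _).trans ?_
    refine (Finset.sum_le_card_nsmul _ _ _ fun i _ =>
      hD.measureReal_mem_and_lt_card_le w T i).trans ?_
    simp
  · refine (measureReal_biUnion_finset_le _ _).trans ?_
    have hterm : ∀ p ∈ s, μ.real (B p.1 p.2.1 ∩ B p.1 p.2.2) ≤ q ^ 2 := fun p hp => by
      simp only [s, Finset.mem_filter, Finset.mem_univ, true_and] at hp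
      have hB := (hD.indep.indepFun hp.2).measure_inter_preimage_eq_mul
        {A | (w ∈ A ∧ p.1 ∈ A) ∧ A.card ≤ 2 * T} {A | (w ∈ A ∧ p.1 ∈ A) ∧ A.card ≤ 2 * T}
        (Set.toFinite _).measurableSet (Set.toFinite _).measurableSet
      have hB' : μ.real (B p.1 p.2.1 ∩ B p.1 p.2.2)
          = μ.real (B p.1 p.2.1) * μ.real (B p.1 p.2.2) := by
        simp only [measureReal_def, ← ENNReal.toReal_mul]
        exact congrArg ENNReal.toReal hB
      rw [hB', sq]
      have h0 := hD.measureReal_mem_mem_card_le_le hm hp.1 (2 * T)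
      exact mul_le_mul (h0 _) (h0 _) measureReal_nonneg (measureReal_nonneg.trans (h0 p.2.1))
    refine (Finset.sum_le_card_nsmul _ _ _ hterm).trans ?_
    rw [nsmul_eq_mul]
    refine mul_le_mul_of_nonneg_right ?_ (sq_nonneg _)
    have : s.card ≤ m * n ^ 2 := by
      refine (Finset.card_le_univ s).trans ?_
      simp [sq]
    exact_mod_cast this

end IsRandomCollection

theorem norm_integral_cexp_sub_le {Ω : Type*} [MeasurableSpace Ω] {μ : Measure Ω}
    [IsProbabilityMeasure μ] {U V : Ω → ℕ} (hU : Measurable U) (hV : Measurable V) (t : ℝ) :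
    ‖(∫ ω, Complex.exp (t * (U ω : ℝ) * Complex.I) ∂μ)
      - ∫ ω, Complex.exp (t * (V ω : ℝ) * Complex.I) ∂μ‖ ≤ 2 * μ.real {ω | U ω ≠ V ω} := by
  have hms : MeasurableSet {ω | U ω ≠ V ω} := (measurableSet_eq_fun hU hV).compl
  have hi : ∀ {W : Ω → ℕ}, Measurable W →
      Integrable (fun ω => Complex.exp (t * (W ω : ℝ) * Complex.I)) μ := fun hW =>
    Integrable.of_bound (by fun_prop) 1 (ae_of_all _ fun ω => (norm_cexp_real_mul_I _ _).le)
  rw [← integral_sub (hi hU) (hi hV), ← integral_indicator_one hms, ← integral_const_mul]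
  refine norm_integral_le_of_norm_le
    (((integrable_const (1 : ℝ)).indicator hms).const_mul 2) (ae_of_all _ fun ω => ?_)
  by_cases h : U ω = V ω
  · simp [h]
  · have : ω ∈ {ω | U ω ≠ V ω} := h
    simp only [Set.indicator_of_mem this, Pi.one_apply, mul_one]
    refine (norm_sub_le _ _).trans ?_
    rw [norm_cexp_real_mul_I, norm_cexp_real_mul_I]; norm_num

/-! ### Convergence in distribution of the number of links and of the degree -/

theorem theorem5
    (β : ℝ) (hβ : 0 < β)
    -- sizes `n k`, `m k` (both at least one) tending to infinity
    (n m : ℕ → ℕ) [∀ k, NeZero (n k)] [∀ k, NeZero (m k)]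
    (hn : Tendsto n atTop atTop) (hm : Tendsto m atTop atTop)
    (hmn : Tendsto (fun k => (m k : ℝ) / (n k : ℝ)) atTop (𝓝 β))
    -- the random sets; the size of `D k 0` plays the role of `X₁`, and `0 : Fin (m k)` is `w₁`
    (P : ∀ k, PMF (Fin (m k + 1)))
    {Ω : ℕ → Type*} [∀ k, MeasurableSpace (Ω k)]
    (μ : ∀ k, Measure (Ω k)) [∀ k, IsProbabilityMeasure (μ k)]
    (D : ∀ k, Fin (n k) → Ω k → Finset (Fin (m k)))
    (hD : ∀ k, IsRandomCollection (P k) (D k) (μ k))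
    -- the limit variable `Z`
    {ΩZ : Type*} [MeasurableSpace ΩZ] (ν : Measure ΩZ) [IsProbabilityMeasure ν] (Z : ΩZ → ℝ)
    (h_vii : TendstoInDistribution (fun k ω => ((D k 0 ω).card : ℝ)) atTop Z μ ν)
    (h_viii : Integrable Z ν ∧
      Tendsto (fun k => ∫ ω, ((D k 0 ω).card : ℝ) ∂(μ k)) atTop (𝓝 (∫ ω, Z ω ∂ν)))
    -- the compound Poisson variable `d_*`, on an arbitrary probability space
    {Ω' : Type*} [MeasurableSpace Ω'] (ν' : Measure Ω') [IsProbabilityMeasure ν']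
    (Λ : Ω' → ℕ) (Zt : ℕ → Ω' → ℕ)
    (hd : IsCompoundPoissonData (β⁻¹ * ∫ ω, Z ω ∂ν)
      (tildeSeq (fun j => ν.real {ω | Z ω = (j : ℝ)})) Λ Zt ν') :
    TendstoInDistribution
        (fun k ω => (linkCount (fun i => D k i ω) (0 : Fin (m k)) : ℝ)) atTop
        (fun ω => (randomSum Λ Zt ω : ℝ)) μ ν' ∧
    ((Integrable (fun ω => Z ω ^ (4 / 3 : ℝ)) ν ∧
        Tendsto (fun k => ∫ ω, ((D k 0 ω).card : ℝ) ^ (4 / 3 : ℝ) ∂(μ k)) atTop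
          (𝓝 (∫ ω, Z ω ^ (4 / 3 : ℝ) ∂ν))) →
      TendstoInDistribution
        (fun k ω => (passiveDegree 1 (fun i => D k i ω) (0 : Fin (m k)) : ℝ)) atTop
        (fun ω => (randomSum Λ Zt ω : ℝ)) μ ν') := by
  have hXm : ∀ k, Measurable (fun ω => ((D k 0 ω).card : ℝ)) := fun k =>
    (hD k).measurable_comp_family fun A => ((A 0).card : ℝ)
  have hXi : ∀ k, Integrable (fun ω => ((D k 0 ω).card : ℝ)) (μ k) := fun k =>
    (hD k).integrable_comp 0 fun A => (A.card : ℝ)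
  have hX0 : ∀ k, ∀ᵐ ω ∂(μ k), (0 : ℝ) ≤ ((D k 0 ω).card : ℝ) := fun k =>
    ae_of_all _ fun ω => Nat.cast_nonneg _
  obtain ⟨hZi, hmean⟩ := h_viii
  have hZ0 : ∀ᵐ ω ∂ν, 0 ≤ Z ω := h_vii.ae_mem_of_isClosed isClosed_Ici hX0
  have hZN : ∀ᵐ ω ∂ν, Z ω ∈ Set.range ((↑) : ℕ → ℝ) :=
    h_vii.ae_mem_of_isClosed Nat.isClosedEmbedding_coe_real.isClosed_range fun k =>
      ae_of_all _ fun ω => ⟨_, rfl⟩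
  have hr : 0 ≤ β⁻¹ * ∫ ω, Z ω ∂ν := mul_nonneg (inv_nonneg.2 hβ.le) (integral_nonneg_of_ae hZ0)
  have hratio : Tendsto (fun k => (n k : ℝ) * (m k : ℝ)⁻¹) atTop (𝓝 β⁻¹) :=
    (hmn.inv₀ hβ.ne').congr fun k => by rw [inv_div, div_eq_mul_inv]
  have hLm : ∀ k, Measurable (fun ω => linkCount (fun i => D k i ω) (0 : Fin (m k))) := fun k =>
    (hD k).measurable_comp_family fun A => linkCount A 0
  have hdm : ∀ k, Measurable (fun ω => passiveDegree 1 (fun i => D k i ω) (0 : Fin (m k))) :=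
    fun k => (hD k).measurable_comp_family fun A => passiveDegree 1 A 0
  have hSm : Measurable (fun ω => randomSum Λ Zt ω) :=
    measurable_sum_range_eval.comp
      (hd.measurable_N.prodMk (measurable_pi_lambda _ hd.measurable_Y))
  have hSm' : AEMeasurable (fun ω => (randomSum Λ Zt ω : ℝ)) ν' := by fun_prop
  have hlink : ∀ t : ℝ, Tendsto (fun k => ∫ ω, Complex.exp
      (t * (linkCount (fun i => D k i ω) (0 : Fin (m k)) : ℝ) * Complex.I) ∂(μ k)) atTop
      (𝓝 (∫ ω, Complex.exp (t * (randomSum Λ Zt ω : ℝ) * Complex.I) ∂ν')) := by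
    intro t
    rw [hd.integral_cexp_randomSum t]
    simp_rw [fun k => (hD k).integral_cexp_linkCount 0 t]
    refine tendsto_one_add_pow_exp_of_tendsto_mul hn ?_
    have hlim := h_vii.tendsto_integral_mul_comp hX0 hXi hZi hmean
      (g := fun x => Complex.exp (t * (x - 1 : ℝ) * Complex.I) - 1) (C := 2) (by fun_prop)
      (fun x => (norm_sub_le _ _).trans (by rw [norm_cexp_real_mul_I]; norm_num))
    rw [← integral_mul_mul_cexp_sub_one hZi hZN (hd.measurable_Y 0) (hd.law_Y 0)] at hlim
    have hrc := (Complex.continuous_ofReal.tendsto _).comp hratio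
    have hprod := hrc.mul hlim
    have hcoe : (((β⁻¹ * ∫ ω, Z ω ∂ν).toNNReal : ℝ) : ℂ)
        = ((β⁻¹ : ℝ) : ℂ) * ((∫ ω, Z ω ∂ν : ℝ) : ℂ) := by
      rw [Real.coe_toNNReal _ hr, Complex.ofReal_mul]
    rw [← mul_assoc, ← hcoe] at hprod
    refine hprod.congr fun k => ?_
    simp only [Function.comp, Complex.ofReal_mul, Complex.ofReal_inv, Complex.ofReal_natCast]
    ring
  refine ⟨tendstoInDistribution_of_charFun (fun k => ?_) hSm' hlink, fun _ =>
    tendstoInDistribution_of_charFun (fun k => ?_) hSm' fun t => ?_⟩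
  · exact (measurable_from_top.comp (hLm k)).aemeasurable
  · exact (measurable_from_top.comp (hdm k)).aemeasurable
  have hne : Tendsto (fun k => (μ k).real {ω | passiveDegree 1 (fun i => D k i ω) (0 : Fin (m k))
      ≠ linkCount (fun i => D k i ω) (0 : Fin (m k))}) atTop (𝓝 0) := by
    have hbound : ∀ T : ℕ, Tendsto (fun k =>
        n k * ((m k : ℝ)⁻¹ * (2 * ∫ ω, max (((D k 0 ω).card : ℝ) - T) 0 ∂(μ k)))
        + m k * (n k : ℝ) ^ 2 * ((2 * T : ℕ) * (∫ ω, ((D k 0 ω).card : ℝ) ∂(μ k))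
          / (m k * (m k - 1))) ^ 2) atTop
        (𝓝 (β⁻¹ * (2 * ∫ ω, max (Z ω - T) 0 ∂ν))) := by
      intro T
      have h1 := hratio.mul ((h_vii.tendsto_integral_max_sub hX0 hXi hZi hmean
        (Nat.cast_nonneg T)).const_mul 2)
      have hmr : Tendsto (fun k => (m k : ℝ)) atTop atTop := tendsto_natCast_atTop_atTop.comp hm
      have hm1 : Tendsto (fun k => ((m k : ℝ) - 1)⁻¹) atTop (𝓝 0) :=
        tendsto_inv_atTop_zero.comp (tendsto_atTop_add_const_right _ (-1) hmr)
      have h2 := ((hratio.pow 2).mul ((hmean.const_mul ((2 * T : ℕ) : ℝ)).pow 2)).mul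
        ((hm1.pow 2).add hm1)
      have h3 := h1.add h2
      simp only [zero_pow two_ne_zero, add_zero, mul_zero] at h3
      refine h3.congr' ?_
      filter_upwards [hm.eventually_ge_atTop 2] with k hk
      have hk2 : (2 : ℝ) ≤ m k := by exact_mod_cast hk
      have ha : (m k : ℝ) ≠ 0 := by positivity
      have hb : (m k : ℝ) - 1 ≠ 0 := by linarith
      rw [mul_assoc (n k : ℝ)]
      congr 1
      field_simp
      ring
    have htail : Tendsto (fun T : ℕ => β⁻¹ * (2 * ∫ ω, max (Z ω - T) 0 ∂ν)) atTop (𝓝 0) := by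
      have := (((tendsto_integral_max_sub_atTop hZi).comp tendsto_natCast_atTop_atTop).const_mul
        2).const_mul β⁻¹
      simpa using this
    -- For fixed `T` the bound converges as `k → ∞`; only afterwards is `T` taken large.
    rw [Metric.tendsto_nhds]
    intro ε hε
    obtain ⟨T, hT⟩ := (htail.eventually_lt_const hε).exists
    filter_upwards [(hbound T).eventually_lt_const hT, hm.eventually_ge_atTop 2] with k hk hk2
    rw [Real.dist_0_eq_abs, abs_of_nonneg measureReal_nonneg]
    exact ((hD k).measureReal_passiveDegree_ne_linkCount_le hk2 0 T).trans_lt hk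
  have hdiff : Tendsto (fun k =>
      (∫ ω, Complex.exp (t * (passiveDegree 1 (fun i => D k i ω) (0 : Fin (m k)) : ℝ)
        * Complex.I) ∂(μ k))
      - ∫ ω, Complex.exp (t * (linkCount (fun i => D k i ω) (0 : Fin (m k)) : ℝ)
        * Complex.I) ∂(μ k)) atTop (𝓝 0) := by
    refine squeeze_zero_norm (fun k => norm_integral_cexp_sub_le (hdm k) (hLm k) t) ?_
    simpa using hne.const_mul 2
  simpa using hdiff.add (hlink t)
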